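/- There is an absolute constant $c>0$ such that for every $n\ge 1$ there are an integer $T\le c\,2^{n/2}$ and a learning algorithm $\mathcal A$ without quantum memory which uses $T$ copies of an unknown $n$-qubit state and has the following two properties. (A learning algorithm without quantum memory measures one copy at a time with a POVM that may depend on all previous outcomes, and computes its answer from the $T$ outcomes.) 1. $\mathcal A$ is a purity tester: on every pure state $|\psi\rangle\langle\psi|$ it answers "pure" with probability at least $2/3$, and on the maximally mixed state $\mathbb 1/2^n$ it answers "maximally mixed" with probability at least $2/3$. 2. Consider the learning algorithm without quantum memory for an unknown $n$-qubit channel $\mathcal C$ which uses $\mathcal C$ exactly $T$ times, each time on the input $|0^n\rangle$ without auxiliary qubits, runs $\mathcal A$ on the $T$ outputs, and answers "unitary" if $\mathcal A$ answers "pure" and "depolarizing" otherwise. This algorithm distinguishes a fixed Haar-random unitary channel from the completely depolarizing channel: if $\mathcal C[\rho]=U\rho U^\dagger$, where $U\in U(2^n)$ is drawn once from the Haar probability measure and is then the same in all $T$ uses, it answers "unitary" with probability at least $2/3$ (over $U$ and the measurement outcomes), and if $\mathcal C[\rho]=\mathrm{Tr}(\rho)\,\mathbb 1/2^n$, it answers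 "depolarizing" with probability at least $2/3$. -/

import Mathlib

open scoped Matrix Kronecker ComplexOrder
open MeasureTheory

noncomputable section

namespace QLearn

/-- Labels of the computational basis of `n` qubits: bit strings of length `n`. -/
abbrev Qubits (n : ℕ) : Type := Fin n → Fin 2

/-- Operators on the Hilbert space with orthonormal basis `ι`. -/
abbrev Op (ι : Type) : Type := Matrix ι ι ℂ

/-- Unit vectors of the Hilbert space with orthonormal basis `ι`. -/
structure PureState (ι : Type) [Fintype ι] where
  vec : ι → ℂ
  normalized : ∑ i, ‖vec i‖ ^ 2 = 1

/-- The density matrix `|ψ⟩⟨ψ|`. -/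
def PureState.density {ι : Type} [Fintype ι] (ψ : PureState ι) : Op ι :=
  Matrix.vecMulVec ψ.vec (star ψ.vec)

/-- The basis vector `|i⟩`. -/
def PureState.basis {ι : Type} [Fintype ι] [DecidableEq ι] (i : ι) : PureState ι where
  vec := Pi.single i 1
  normalized := by
    rw [Finset.sum_eq_single i]
    · simp
    · intro b _ hb
      simp [hb]
    · simp

/-- The maximally mixed state `1 / dim`. -/
def maximallyMixed (ι : Type) [Fintype ι] [DecidableEq ι] : Op ι :=
  ((Fintype.card ι : ℂ)⁻¹) • (1 : Op ι)

/-- A positive operator-valued measure with `k` outcomes. -/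
structure POVM (ι : Type) [DecidableEq ι] (k : ℕ) where
  elem : Fin k → Op ι
  posSemidef : ∀ s, (elem s).PosSemidef
  sum_eq_one : ∑ s, elem s = 1

/-- The probability `Tr (F_s ρ)` of the outcome `s` on the state `ρ`. -/
def POVM.outcomeProb {ι : Type} [Fintype ι] [DecidableEq ι] {k : ℕ} (F : POVM ι k)
    (ρ : Op ι) (s : Fin k) : ℝ :=
  ((F.elem s * ρ).trace).re

/-- The same measurement on an isomorphic system. -/
def POVM.reindex {ι κ : Type} [DecidableEq ι] [DecidableEq κ] {k : ℕ} (e : κ ≃ ι)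
    (F : POVM ι k) : POVM κ k where
  elem := fun s => (F.elem s).submatrix e e
  posSemidef := fun s => (F.posSemidef s).submatrix e
  sum_eq_one := by
    have h := congrArg (fun M : Op ι => M.submatrix e e) F.sum_eq_one
    simp only [Matrix.submatrix_one_equiv] at h
    rw [← h]
    ext i j
    simp [Matrix.sum_apply]

/-- `(Φ ⊗ id) ρ` for a linear map `Φ` on the first tensor factor of a bipartite system. -/
def ampliate {ι : Type} (Φ : Op ι →ₗ[ℂ] Op ι) {κ : Type} (ρ : Op (ι × κ)) : Op (ι × κ) :=
  Matrix.of fun p q => Φ (Matrix.of fun i j => ρ (i, p.2) (j, q.2)) p.1 q.1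

/-- Quantum channels: completely positive trace-preserving linear maps. -/
structure Channel (ι : Type) [Fintype ι] where
  map : Op ι →ₗ[ℂ] Op ι
  completelyPositive : ∀ (m : ℕ) (ρ : Op (ι × Fin m)), ρ.PosSemidef → (ampliate map ρ).PosSemidef
  tracePreserving : ∀ ρ : Op ι, (map ρ).trace = ρ.trace

/-- The unitary channel `ρ ↦ U ρ U†`. -/
def unitaryChannel {ι : Type} [Fintype ι] [DecidableEq ι] (U : Matrix.unitaryGroup ι ℂ) :
    Channel ι where
  map :=
    { toFun := fun ρ => (U : Op ι) * ρ * (U : Op ι)ᴴ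
      map_add' := fun ρ σ => by rw [Matrix.mul_add, Matrix.add_mul]
      map_smul' := fun c ρ => by simp }
  completelyPositive := fun m ρ hρ => by
    have h := hρ.mul_mul_conjTranspose_same ((U : Op ι) ⊗ₖ (1 : Op (Fin m)))
    convert h using 1
    ext ⟨i, a⟩ ⟨j, b⟩
    simp [ampliate, Matrix.mul_apply, Fintype.sum_prod_type, Matrix.kroneckerMap_apply,
      Matrix.one_apply, Finset.sum_ite_eq, apply_ite]
  tracePreserving := fun ρ => by
    have hU : (U : Op ι)ᴴ * (U : Op ι) = 1 := Matrix.mem_unitaryGroup_iff'.1 U.2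
    change ((U : Op ι) * ρ * (U : Op ι)ᴴ).trace = ρ.trace
    rw [Matrix.trace_mul_comm, ← Matrix.mul_assoc, hU, Matrix.one_mul]

/-- The completely depolarizing channel `ρ ↦ Tr(ρ) 1 / dim`. -/
def depolarizingChannel (ι : Type) [Fintype ι] [DecidableEq ι] [Nonempty ι] : Channel ι where
  map :=
    { toFun := fun ρ => ρ.trace • maximallyMixed ι
      map_add' := fun ρ σ => by rw [Matrix.trace_add, add_smul]
      map_smul' := fun c ρ => by
        rw [Matrix.trace_smul, smul_eq_mul, mul_smul, RingHom.id_apply] }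
  completelyPositive := fun m ρ hρ => by
    have h : (∑ k : ι, ((Fintype.card ι : ℂ)⁻¹ • (1 : Op ι)) ⊗ₖ
        (ρ.submatrix (fun a : Fin m => (k, a)) (fun a : Fin m => (k, a)))).PosSemidef :=
      Matrix.posSemidef_sum _ fun k _ =>
        (Matrix.PosSemidef.one.smul (by positivity)).kronecker (hρ.submatrix _)
    convert h using 1
    ext ⟨i, a⟩ ⟨j, b⟩
    simp only [ampliate, maximallyMixed, Matrix.trace, Matrix.diag, Matrix.sum_apply,
      Matrix.kroneckerMap_apply, Matrix.of_apply, Matrix.smul_apply, Matrix.submatrix_apply,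
      LinearMap.coe_mk, AddHom.coe_mk, smul_eq_mul, Finset.sum_mul]
    exact Finset.sum_congr rfl fun k _ => mul_comm _ _
  tracePreserving := fun ρ => by
    have h : (Fintype.card ι : ℂ) ≠ 0 := by exact_mod_cast Fintype.card_ne_zero
    simp [maximallyMixed, h]

/-- A learning algorithm without quantum memory that uses `T` copies of an unknown `n`-qubit state
and answers with an element of `α`: at every internal node of the tree one copy is measured with a
POVM, and the outcome (the whole transcript, that is, the node reached) determines how to go on. -/
inductive StateLearner (n : ℕ) (α : Type) : ℕ → Type
  | answer (a : α) : StateLearner n α 0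
  | measure {T k : ℕ} (F : POVM (Qubits n) k) (next : Fin k → StateLearner n α T) :
      StateLearner n α (T + 1)

/-- The probability that the learner answers `b` when the unknown state is `ρ`. -/
def StateLearner.prob {n : ℕ} {α : Type} [DecidableEq α] (ρ : Op (Qubits n)) (b : α) :
    {T : ℕ} → StateLearner n α T → ℝ
  | _, .answer a => if a = b then 1 else 0
  | _, .measure F next => ∑ s, F.outcomeProb ρ s * (next s).prob ρ b

/-- A learning algorithm without quantum memory that uses an unknown `n`-qubit channel `T` times,
with `n'` auxiliary qubits: at every internal node it prepares a pure state of `n + n'` qubits,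
applies the channel to the first `n` of them and measures all qubits with a POVM; state and POVM may
depend on all previous outcomes. -/
inductive ChannelLearner (n n' : ℕ) (α : Type) : ℕ → Type
  | answer (a : α) : ChannelLearner n n' α 0
  | experiment {T k : ℕ} (φ : PureState (Qubits n × Qubits n'))
      (F : POVM (Qubits n × Qubits n') k) (next : Fin k → ChannelLearner n n' α T) : ChannelLearner n n' α (T + 1)

/-- The probability that the learner answers `b` when the unknown channel is `C`. -/
def ChannelLearner.prob {n n' : ℕ} {α : Type} [DecidableEq α] (C : Channel (Qubits n)) (b : α) :
    {T : ℕ} → ChannelLearner n n' α T → ℝ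
  | _, .answer a => if a = b then 1 else 0
  | _, .experiment φ F next =>
      ∑ s, F.outcomeProb (ampliate C.map φ.density) s * (next s).prob C b

/-- Feed `|0ⁿ⟩` (without auxiliary qubits) into the unknown channel in every experiment and run the
state learner on the outputs. -/
def StateLearner.onZeroInput {n : ℕ} {α : Type} :
    {T : ℕ} → StateLearner n α T → ChannelLearner n 0 α T
  | _, .answer a => .answer a
  | _, .measure F next =>
      .experiment (PureState.basis (0, 0))
        (F.reindex (Equiv.prodUnique (Qubits n) (Qubits 0))) (fun s => (next s).onZeroInput)

/-- The learner decides (`true` for "pure", `false` for "maximally mixed"), with probability at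
least `2/3` in each case, whether the unknown state is an arbitrary pure state or maximally
mixed. -/
def IsPurityTester {n T : ℕ} (A : StateLearner n Bool T) : Prop :=
  (∀ ψ : PureState (Qubits n), 2 / 3 ≤ A.prob ψ.density true) ∧
    2 / 3 ≤ A.prob (maximallyMixed (Qubits n)) false

section Haar

variable (ι : Type) [Fintype ι] [DecidableEq ι]

instance unitaryGroup_compactSpace : CompactSpace (Matrix.unitaryGroup ι ℂ) := by
  have hc : IsCompact (Set.univ.pi fun _ : ι => Set.univ.pi fun _ : ι =>
      Metric.closedBall (0 : ℂ) 1) :=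
    isCompact_univ_pi fun _ => isCompact_univ_pi fun _ => isCompact_closedBall _ _
  have hcl : IsClosed {M : Matrix ι ι ℂ | M * star M = 1} :=
    isClosed_eq (by fun_prop) continuous_const
  have hs : ((Matrix.unitaryGroup ι ℂ : Submonoid (Matrix ι ι ℂ)) : Set (Matrix ι ι ℂ)) =
      {M | M * star M = 1} := by
    ext M
    exact Matrix.mem_unitaryGroup_iff
  apply isCompact_iff_compactSpace.1
  refine hc.of_isClosed_subset (hs ▸ hcl) ?_
  intro M hM i _ j _
  simpa using entry_norm_bound_of_unitary hM i j

instance unitaryGroup_measurableSpace : MeasurableSpace (Matrix.unitaryGroup ι ℂ) :=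
  borel _

instance unitaryGroup_borelSpace : BorelSpace (Matrix.unitaryGroup ι ℂ) := ⟨rfl⟩

/-- The Haar probability measure on the unitary group. -/
def haarUnitary : Measure (Matrix.unitaryGroup ι ℂ) :=
  Measure.haarMeasure ⊤

end Haar

/-- The learner decides (`true` for "unitary", `false` for "depolarizing"), with probability at
least `2/3` in each case, whether the unknown channel is `ρ ↦ U ρ U†`, with a Haar-random `U` that
is drawn once and then the same in all `T` uses, or the completely depolarizing channel. -/
def DistinguishesHaarUnitaryFromDepolarizing {n n' T : ℕ} (A : ChannelLearner n n' Bool T) : Prop :=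
  2 / 3 ≤ ∫ U, A.prob (unitaryChannel U) true ∂(haarUnitary (Qubits n)) ∧
    2 / 3 ≤ A.prob (depolarizingChannel (Qubits n)) false

end QLearn

end

/-! Write `d = 2 ^ n`. The tester estimates collision probabilities by counting coincidences between
two batches of `B` copies, where `B ^ 2` lies between `d` and `2 * d`. This is done in two bases: a
Walsh–Hadamard basis twisted by random fourth roots of unity, and the computational basis. On the
maximally mixed state both collision probabilities are `1 / d`.

For a pure state let `S` be the sum of the `‖ψ t‖ ^ 4`. An amplitude in the twisted basis is `1 /
√d` times a random-phase sum with fourth moment `2 - S`, so the mean collision probability is `(2 -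
S) / d` (`average_powerSum_two_walshPOVM`). This alone misses basis states, where `S = 1`, but the
computational basis contributes exactly `S`. The total is `2 / d + S * (1 - 1 / d)` against `2 / d`.
As `S ≥ 1 / d` and `n ≥ 1`, the mean counts differ by at least `B ^ 2 * S / 2 ≥ 1 / 2`.

Moment bounds keep the spread of a round of order `B ^ 2 * S` on pure states and of order one on the
mixed state, so constantly many rounds and Chebyshev's inequality suffice.

For channels, the output on `|0ⁿ⟩` is pure for every `U`, so the success bound holds pointwise in
`U` and survives the Haar average. -/

namespace QLearn

/-! ### Expectations of answers of adaptive learners -/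

/-- The expected value of `f` at the answer of the learner when the unknown state is `ρ`. -/
noncomputable def StateLearner.ev {n : ℕ} {α : Type} (ρ : Op (Qubits n)) (f : α → ℝ) :
    {T : ℕ} → StateLearner n α T → ℝ
  | _, .answer a => f a
  | _, .measure F next => ∑ s, F.outcomeProb ρ s * (next s).ev ρ f

/-- Run a learner and continue with a learner that depends on its answer. -/
def StateLearner.bind {n S : ℕ} {α β : Type} (g : α → StateLearner n β S) :
    {T : ℕ} → StateLearner n α T → StateLearner n β (S + T)
  | _, .answer a => g a
  | _, .measure F next => .measure F fun s => (next s).bind g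

/-- Apply a function to the answer of a learner. -/
def StateLearner.map {n : ℕ} {α β : Type} (g : α → β) :
    {T : ℕ} → StateLearner n α T → StateLearner n β T
  | _, .answer a => .answer (g a)
  | _, .measure F next => .measure F fun s => (next s).map g

/-- Run a learner `m` times and add up the answers. -/
def StateLearner.sumIid {n S : ℕ} {α : Type} [AddCommMonoid α] (A : StateLearner n α S) :
    (m : ℕ) → StateLearner n α (S * m)
  | 0 => .answer 0
  | m + 1 => A.bind fun a => (A.sumIid m).map (a + ·)

/-- Density matrices. -/
structure IsDensity {ι : Type} [Fintype ι] (ρ : Op ι) : Prop where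
  posSemidef : ρ.PosSemidef
  trace_eq_one : ρ.trace = 1

section Outcome

variable {ι : Type} [Fintype ι]

theorem PureState.isDensity (ψ : PureState ι) : IsDensity ψ.density where
  posSemidef := Matrix.posSemidef_vecMulVec_self_star _
  trace_eq_one := by
    have h := ψ.normalized
    simp only [PureState.density, Matrix.trace_vecMulVec, dotProduct, Pi.star_apply]
    have : ∀ i, ψ.vec i * star (ψ.vec i) = ((‖ψ.vec i‖ ^ 2 : ℝ) : ℂ) := fun i => by
      rw [Complex.star_def, Complex.mul_conj, Complex.normSq_eq_norm_sq]
    simp only [this]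
    rw [← Complex.ofReal_sum, h, Complex.ofReal_one]

theorem maximallyMixed_isDensity [DecidableEq ι] [Nonempty ι] : IsDensity (maximallyMixed ι) where
  posSemidef := Matrix.PosSemidef.one.smul (by positivity)
  trace_eq_one := by
    have h : (Fintype.card ι : ℂ) ≠ 0 := by exact_mod_cast Fintype.card_ne_zero
    simp [maximallyMixed, h]

open scoped MatrixOrder Matrix.Norms.L2Operator in
-- With `B = C * Cᴴ`, cyclicity turns the trace into that of the positive semidefinite `Cᴴ * A * C`.
theorem trace_mul_nonneg_of_posSemidef [DecidableEq ι] {A B : Op ι} (hA : A.PosSemidef) (hB : B.PosSemidef) :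
    0 ≤ ((A * B).trace).re := by
  obtain ⟨C, rfl⟩ : ∃ C : Op ι, B = C * Cᴴ := by
    obtain ⟨C, hC⟩ := CStarAlgebra.nonneg_iff_eq_star_mul_self.1 hB.nonneg
    exact ⟨Cᴴ, by rw [hC, Matrix.star_eq_conjTranspose, Matrix.conjTranspose_conjTranspose]⟩
  rw [← Matrix.mul_assoc, Matrix.trace_mul_comm, ← Matrix.mul_assoc]
  exact (Complex.le_def.1 (hA.conjTranspose_mul_mul_same C).trace_nonneg).1

theorem POVM.outcomeProb_nonneg [DecidableEq ι] {k : ℕ} (F : POVM ι k) {ρ : Op ι} (hρ : IsDensity ρ) (s : Fin k) :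
    0 ≤ F.outcomeProb ρ s :=
  trace_mul_nonneg_of_posSemidef (F.posSemidef s) hρ.posSemidef

theorem POVM.sum_outcomeProb [DecidableEq ι] {k : ℕ} (F : POVM ι k) {ρ : Op ι} (hρ : IsDensity ρ) :
    ∑ s, F.outcomeProb ρ s = 1 := by
  simp only [POVM.outcomeProb]
  rw [← Complex.re_sum, ← Matrix.trace_sum, ← Matrix.sum_mul, F.sum_eq_one, Matrix.one_mul,
    hρ.trace_eq_one, Complex.one_re]

end Outcome

namespace StateLearner

variable {n : ℕ} {α β : Type} {ρ : Op (Qubits n)}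

theorem prob_eq_ev [DecidableEq α] (b : α) {T : ℕ} (A : StateLearner n α T) :
    A.prob ρ b = A.ev ρ fun a => if a = b then 1 else 0 := by
  induction A with
  | answer a => rfl
  | measure F next ih => simp only [prob, ev, ih]

theorem ev_bind {S T : ℕ} (g : α → StateLearner n β S) (A : StateLearner n α T) (f : β → ℝ) :
    (A.bind g).ev ρ f = A.ev ρ fun a => (g a).ev ρ f := by
  induction A with
  | answer a => rfl
  | measure F next ih => simp only [bind, ev, ih]

theorem ev_map {T : ℕ} (g : α → β) (A : StateLearner n α T) (f : β → ℝ) :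
    (A.map g).ev ρ f = A.ev ρ fun a => f (g a) := by
  induction A with
  | answer a => rfl
  | measure F next ih => simp only [map, ev, ih]

theorem ev_add {T : ℕ} (A : StateLearner n α T) (f g : α → ℝ) :
    A.ev ρ (fun a => f a + g a) = A.ev ρ f + A.ev ρ g := by
  induction A with
  | answer a => rfl
  | measure F next ih => simp only [ev, ih, mul_add, Finset.sum_add_distrib]

theorem ev_const_mul {T : ℕ} (A : StateLearner n α T) (c : ℝ) (f : α → ℝ) :
    A.ev ρ (fun a => c * f a) = c * A.ev ρ f := by
  induction A with
  | answer a => rfl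
  | measure F next ih =>
    simp only [ev, ih, Finset.mul_sum]
    exact Finset.sum_congr rfl fun s _ => by ring

theorem ev_mul_const {T : ℕ} (A : StateLearner n α T) (c : ℝ) (f : α → ℝ) :
    A.ev ρ (fun a => f a * c) = A.ev ρ f * c := by
  simpa only [mul_comm] using A.ev_const_mul (ρ := ρ) c f

theorem ev_const (hρ : IsDensity ρ) {T : ℕ} (A : StateLearner n α T) (c : ℝ) :
    A.ev ρ (fun _ => c) = c := by
  induction A with
  | answer a => rfl
  | measure F next ih => simp only [ev, ih, ← Finset.sum_mul, F.sum_outcomeProb hρ, one_mul]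

theorem ev_sum {κ : Type} (u : Finset κ) {T : ℕ} (A : StateLearner n α T) (f : κ → α → ℝ) :
    A.ev ρ (fun a => ∑ i ∈ u, f i a) = ∑ i ∈ u, A.ev ρ (f i) := by
  induction A with
  | answer a => rfl
  | measure F next ih =>
    simp only [ev, ih, Finset.mul_sum]
    exact Finset.sum_comm

theorem ev_mono (hρ : IsDensity ρ) {T : ℕ} (A : StateLearner n α T) {f g : α → ℝ}
    (h : ∀ a, f a ≤ g a) : A.ev ρ f ≤ A.ev ρ g := by
  induction A with
  | answer a => exact h a
  | measure F next ih =>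
    exact Finset.sum_le_sum fun s _ => mul_le_mul_of_nonneg_left (ih s) (F.outcomeProb_nonneg hρ s)

theorem ev_sumIid [AddCommMonoid α] (hρ : IsDensity ρ) {S : ℕ} (A : StateLearner n α S) (L : α →+ ℝ) (m : ℕ) :
    (A.sumIid m).ev ρ (fun a => L a) = m * A.ev ρ fun a => L a := by
  induction m with
  | zero => simp [sumIid, ev]
  | succ m ih =>
    simp only [sumIid, ev_bind, ev_map, map_add, ev_add, ih, ev_const hρ]
    push_cast; ring

/-- The `m` diagonal pairs of runs contribute the joint moment, and the `m * (m - 1)` pairs of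
distinct runs factor by independence. Two functionals are allowed in order to cover mixed moments of
outcome counts. -/
theorem ev_mul_sumIid [AddCommMonoid α] (hρ : IsDensity ρ) {S : ℕ} (A : StateLearner n α S) (L M : α →+ ℝ) (m : ℕ) :
    (A.sumIid m).ev ρ (fun a => L a * M a) =
      m * A.ev ρ (fun a => L a * M a) +
        m * (m - 1) * (A.ev ρ (fun a => L a) * A.ev ρ fun a => M a) := by
  induction m with
  | zero => simp [sumIid, ev]
  | succ m ih =>
    simp only [sumIid, ev_bind, ev_map, map_add, add_mul, mul_add, ev_add, ih, ev_const hρ,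
      ev_const_mul, ev_mul_const, ev_sumIid hρ]
    push_cast; ring

/-- Chebyshev's inequality. -/
theorem ev_indicator_le (hρ : IsDensity ρ) {T : ℕ} (A : StateLearner n α T) (f : α → ℝ)
    {P : α → Prop} [DecidablePred P] {t : ℝ} (ht : 0 < t) (h : ∀ a, P a → t ^ 2 ≤ f a ^ 2) :
    A.ev ρ (fun a => if P a then 1 else 0) ≤ A.ev ρ (fun a => f a ^ 2) / t ^ 2 := by
  rw [div_eq_inv_mul, ← ev_const_mul]
  refine A.ev_mono hρ fun a => ?_
  split_ifs with hP
  · rw [← div_eq_inv_mul, le_div_iff₀ (by positivity), one_mul]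
    exact h a hP
  · positivity

theorem ev_sub_sq (hρ : IsDensity ρ) {T : ℕ} (A : StateLearner n ℝ T) (x : ℝ) :
    A.ev ρ (fun a => (a - x) ^ 2) =
      A.ev ρ (fun a => a * a) - 2 * x * A.ev ρ (fun a => a) + x ^ 2 := by
  rw [← ev_const hρ A (x ^ 2), sub_eq_add_neg, ← neg_mul, ← ev_const_mul, ← ev_add, ← ev_add]
  congr 1; ext a; ring

/-- Variances of independent runs add, and the mean minimises the second moment about a point. The
free centre `c` spares computing exact variances later. -/
theorem ev_sumIid_sub_sq_le (hρ : IsDensity ρ) {S : ℕ} (A : StateLearner n ℝ S) (m : ℕ) (c : ℝ) :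
    (A.sumIid m).ev ρ (fun a => (a - m * A.ev ρ id) ^ 2) ≤ m * A.ev ρ fun a => (a - c) ^ 2 := by
  have h1 := ev_sumIid hρ A (AddMonoidHom.id ℝ) m
  have h2 := ev_mul_sumIid hρ A (AddMonoidHom.id ℝ) (AddMonoidHom.id ℝ) m
  simp only [AddMonoidHom.id_apply] at h1 h2
  have h4 : A.ev ρ id = A.ev ρ fun a => a := rfl
  rw [ev_sub_sq hρ, ev_sub_sq hρ, h1, h2, h4]
  nlinarith [mul_nonneg (Nat.cast_nonneg (α := ℝ) m) (sq_nonneg (A.ev ρ (fun a => a) - c))]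

end StateLearner

end QLearn

/-! ### Coincidence counts between two batches -/

namespace QLearn

/-- The sum of the `r`-th powers of the outcome probabilities. -/
noncomputable def POVM.powerSum {ι : Type} [Fintype ι] [DecidableEq ι] {k : ℕ} (F : POVM ι k)
    (ρ : Op ι) (r : ℕ) : ℝ :=
  ∑ s, F.outcomeProb ρ s ^ r

namespace StateLearner

variable {n k : ℕ} {ρ : Op (Qubits n)}

/-- Measure one copy and answer with the indicator vector of the outcome. -/
noncomputable def sample (F : POVM (Qubits n) k) : StateLearner n (Fin k → ℝ) 1 :=
  .measure F fun s => .answer (Pi.single s 1)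

theorem ev_sample (F : POVM (Qubits n) k) (s : Fin k) :
    (sample F).ev ρ (fun a => a s) = F.outcomeProb ρ s := by
  simp [sample, ev, Pi.single_apply]

theorem ev_sample_mul (F : POVM (Qubits n) k) (s t : Fin k) :
    (sample F).ev ρ (fun a => a s * a t) = if s = t then F.outcomeProb ρ s else 0 := by
  simp only [sample, ev, Pi.single_apply]
  rw [Finset.sum_eq_single s]
  · simp [eq_comm]
  · intro b _ hb
    simp [hb.symm]
  · simp

/-- Measure two batches of `T` copies each and count the coincidences between the batches. -/
noncomputable def collisions (F : POVM (Qubits n) k) (T : ℕ) : StateLearner n ℝ (1 * T + 1 * T) :=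
  ((sample F).sumIid T).bind fun x => ((sample F).sumIid T).map fun y => ∑ s, x s * y s

theorem ev_collisions (hρ : IsDensity ρ) (F : POVM (Qubits n) k) (T : ℕ) :
    (collisions F T).ev ρ (fun a => a) = T ^ 2 * F.powerSum ρ 2 := by
  have h1 : ∀ s, ((sample F).sumIid T).ev ρ (fun a => a s) = T * F.outcomeProb ρ s := fun s =>
    (ev_sumIid hρ (sample F) (Pi.evalAddMonoidHom (fun _ => ℝ) s) T).trans
      (congrArg _ (ev_sample F s))
  simp only [collisions, ev_bind, ev_map, ev_sum, ev_const_mul, ev_mul_const, h1, POVM.powerSum,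
    Finset.mul_sum]
  exact Finset.sum_congr rfl fun s _ => by ring

/-- The batches are independent and equally distributed, so the second moment is the sum over `s`,
`t` of the squared mixed moment of the counts of `s` and `t` in one batch. Only `s = t` produces
terms beyond the product of means. -/
theorem ev_collisions_sq (hρ : IsDensity ρ) (F : POVM (Qubits n) k) (T : ℕ) :
    (collisions F T).ev ρ (fun a => a ^ 2) =
      T ^ 2 * F.powerSum ρ 2 + 2 * (T ^ 2 * (T - 1)) * F.powerSum ρ 3 +
        (T * (T - 1)) ^ 2 * F.powerSum ρ 2 ^ 2 := by
  have h2 : ∀ s t, ((sample F).sumIid T).ev ρ (fun a => a s * a t) =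
      T * (if s = t then F.outcomeProb ρ s else 0) +
        T * (T - 1) * (F.outcomeProb ρ s * F.outcomeProb ρ t) := fun s t => by
    rw [← ev_sample_mul, ← ev_sample F s, ← ev_sample F t]
    exact ev_mul_sumIid hρ (sample F) (Pi.evalAddMonoidHom (fun _ => ℝ) s)
      (Pi.evalAddMonoidHom (fun _ => ℝ) t) T
  have h3 : ∀ x y : Fin k → ℝ, (∑ s, x s * y s) ^ 2 = ∑ s, ∑ t, x s * x t * (y s * y t) :=
    fun x y => by
      rw [sq, Finset.sum_mul_sum]
      exact Finset.sum_congr rfl fun s _ => Finset.sum_congr rfl fun t _ => by ring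
  simp only [collisions, ev_bind, ev_map, h3, ev_sum, ev_const_mul, ev_mul_const, h2]
  have h4 : ∀ s t, (T * (if s = t then F.outcomeProb ρ s else 0) +
        T * (T - 1) * (F.outcomeProb ρ s * F.outcomeProb ρ t)) *
      (T * (if s = t then F.outcomeProb ρ s else 0) +
        T * (T - 1) * (F.outcomeProb ρ s * F.outcomeProb ρ t)) =
      (if s = t then T ^ 2 * F.outcomeProb ρ s ^ 2 +
        2 * (T ^ 2 * (T - 1)) * F.outcomeProb ρ s ^ 3 else 0) +
      (T * (T - 1)) ^ 2 * (F.outcomeProb ρ s ^ 2 * F.outcomeProb ρ t ^ 2) := fun s t => by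
    split_ifs with h
    · subst h; ring
    · ring
  simp only [h4, Finset.sum_add_distrib, Finset.sum_ite_eq, Finset.mem_univ, if_true,
    ← Finset.mul_sum, ← Finset.sum_mul, POVM.powerSum]
  ring

theorem ev_collisions_sq_le (hρ : IsDensity ρ) (F : POVM (Qubits n) k) (T : ℕ) :
    (collisions F T).ev ρ (fun a => a ^ 2) ≤
      T ^ 2 * F.powerSum ρ 2 + 2 * T ^ 3 * F.powerSum ρ 3 + T ^ 4 * F.powerSum ρ 2 ^ 2 := by
  rw [ev_collisions_sq hρ]
  have h3 : 0 ≤ F.powerSum ρ 3 :=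
    Finset.sum_nonneg fun s _ => pow_nonneg (F.outcomeProb_nonneg hρ s) 3
  have hT : (0 : ℝ) ≤ T := T.cast_nonneg
  have h1 : (T : ℝ) ^ 2 * (T - 1) ≤ T ^ 3 := by nlinarith [sq_nonneg (T : ℝ)]
  have h2 : ((T : ℝ) * (T - 1)) ^ 2 ≤ T ^ 4 := by
    rcases T.eq_zero_or_pos with rfl | h
    · simp
    · have h1 : (1 : ℝ) ≤ T := by exact_mod_cast h
      have : ((T : ℝ) * (T - 1)) ^ 2 ≤ (T * T) ^ 2 :=
        pow_le_pow_left₀ (mul_nonneg hT (by linarith))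
          (mul_le_mul_of_nonneg_left (by linarith) hT) 2
      calc _ ≤ _ := this
        _ = _ := by ring
  have := mul_le_mul_of_nonneg_right h1 h3
  have := mul_le_mul_of_nonneg_right h2 (sq_nonneg (F.powerSum ρ 2))
  linarith

theorem ev_collisions_variance_le (hρ : IsDensity ρ) (F : POVM (Qubits n) k) (T : ℕ) :
    (collisions F T).ev ρ (fun a => (a - T ^ 2 * F.powerSum ρ 2) ^ 2) ≤
      T ^ 2 * F.powerSum ρ 2 + 2 * T ^ 3 * F.powerSum ρ 3 := by
  have h := ev_collisions_sq_le hρ F T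
  simp only [sq (_ : ℝ)] at h
  rw [ev_sub_sq hρ, ev_collisions hρ]
  linarith

/-- Measure one copy with a trivial measurement to draw an element of `Ω` uniformly at random. -/
noncomputable def uniform (n : ℕ) (Ω : Type) [Fintype Ω] [Nonempty Ω] : StateLearner n Ω 1 :=
  .measure
    { elem := fun _ : Fin (Fintype.card Ω) => ((Fintype.card Ω : ℂ)⁻¹) • (1 : Op (Qubits n))
      posSemidef := fun _ => Matrix.PosSemidef.one.smul (by positivity)
      sum_eq_one := by
        have h : (Fintype.card Ω : ℂ) ≠ 0 := by exact_mod_cast Fintype.card_ne_zero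
        rw [Finset.sum_const, Finset.card_univ, Fintype.card_fin, ← Nat.cast_smul_eq_nsmul ℂ,
          smul_smul, mul_inv_cancel₀ h, one_smul] }
    fun s => .answer ((Fintype.equivFin Ω).symm s)

theorem ev_uniform (hρ : IsDensity ρ) {Ω : Type} [Fintype Ω] [Nonempty Ω] (f : Ω → ℝ) :
    (uniform n Ω).ev ρ f = (Fintype.card Ω : ℝ)⁻¹ * ∑ ω, f ω := by
  simp only [uniform, ev, POVM.outcomeProb, Matrix.smul_mul, Matrix.one_mul, Matrix.trace_smul,
    hρ.trace_eq_one, smul_eq_mul, mul_one, ← Finset.mul_sum]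
  rw [(Fintype.equivFin Ω).symm.sum_comp]
  congr 1
  rw [← Complex.ofReal_natCast, ← Complex.ofReal_inv, Complex.ofReal_re]

/-- Count coincidences in a random basis and in a fixed basis, and add up the results. -/
noncomputable def collisionRound {Ω : Type} [Fintype Ω] [Nonempty Ω] (F : Ω → POVM (Qubits n) k)
    (G : POVM (Qubits n) k) (T : ℕ) :
    StateLearner n ℝ ((1 * T + 1 * T) + (1 * T + 1 * T) + 1) :=
  (uniform n Ω).bind fun ω => (collisions (F ω) T).bind fun x => (collisions G T).map (x + ·)

section Round

variable {Ω : Type} [Fintype Ω] [Nonempty Ω] (F : Ω → POVM (Qubits n) k) (G : POVM (Qubits n) k)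
  (T : ℕ)

theorem ev_collisionRound (hρ : IsDensity ρ) :
    (collisionRound F G T).ev ρ id =
      T ^ 2 * ((Fintype.card Ω : ℝ)⁻¹ * ∑ ω, (F ω).powerSum ρ 2) + T ^ 2 * G.powerSum ρ 2 := by
  have h1 : ∀ x, (collisions G T).ev ρ (fun y => x + y) = x + T ^ 2 * G.powerSum ρ 2 := fun x => by
    rw [ev_add _ (fun _ => x) fun y => y, ev_const hρ, ev_collisions hρ]
  have h2 : ∀ ω c, (collisions (F ω) T).ev ρ (fun x => x + c) =
      T ^ 2 * (F ω).powerSum ρ 2 + c := fun ω c => by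
    rw [ev_add _ (fun x => x) fun _ => c, ev_const hρ, ev_collisions hρ]
  simp only [collisionRound, ev_bind, ev_map, id, h1, h2]
  rw [ev_add, ev_const hρ, ev_const_mul, ev_uniform hρ]

/-- From `(x + y) ^ 2 ≤ 2 * x ^ 2 + 2 * y ^ 2`, with separate centres for the two counts. -/
theorem ev_collisionRound_sub_sq_le (hρ : IsDensity ρ) (c c' : ℝ) :
    (collisionRound F G T).ev ρ (fun a => (a - (c + c')) ^ 2) ≤
      2 * ((Fintype.card Ω : ℝ)⁻¹ * ∑ ω, (collisions (F ω) T).ev ρ fun a => (a - c) ^ 2) +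
        2 * (collisions G T).ev ρ fun a => (a - c') ^ 2 := by
  simp only [collisionRound, ev_bind, ev_map]
  rw [← ev_uniform hρ, ← ev_const_mul]
  refine le_of_le_of_eq (ev_mono hρ _ fun ω => ev_mono hρ _ fun x => ev_mono hρ _ fun y =>
    show (x + y - (c + c')) ^ 2 ≤ 2 * (x - c) ^ 2 + 2 * (y - c') ^ 2 by
      nlinarith [sq_nonneg (x - c - (y - c'))]) ?_
  simp only [ev_add, ev_const hρ, ev_const_mul]

end Round

end StateLearner

end QLearn

/-! ### Moments of sums with random fourth roots of unity -/

namespace QLearn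

/-- The fourth roots of unity. -/
noncomputable def phase : Fin 4 → ℂ := ![1, Complex.I, -1, -Complex.I]

theorem norm_phase (k : Fin 4) : ‖phase k‖ = 1 := by
  fin_cases k <;> simp [phase]

theorem sum_norm_add_phase_mul_pow_two (y a : ℂ) :
    ∑ k, ‖y + phase k * a‖ ^ 2 = 4 * (‖y‖ ^ 2 + ‖a‖ ^ 2) := by
  simp only [← Complex.normSq_eq_norm_sq, Complex.normSq_apply, Fin.sum_univ_four, phase]
  simp
  ring

theorem sum_norm_add_phase_mul_pow_four (y a : ℂ) :
    ∑ k, (‖y + phase k * a‖ ^ 2) ^ 2 =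
      4 * ((‖y‖ ^ 2) ^ 2 + 4 * (‖y‖ ^ 2 * ‖a‖ ^ 2) + (‖a‖ ^ 2) ^ 2) := by
  simp only [← Complex.normSq_eq_norm_sq, Complex.normSq_apply, Fin.sum_univ_four, phase]
  simp
  ring

theorem sum_norm_add_phase_mul_pow_six (y a : ℂ) :
    ∑ k, (‖y + phase k * a‖ ^ 2) ^ 3 =
      4 * ((‖y‖ ^ 2) ^ 3 + 9 * ((‖y‖ ^ 2) ^ 2 * ‖a‖ ^ 2) + 9 * (‖y‖ ^ 2 * (‖a‖ ^ 2) ^ 2) +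
        (‖a‖ ^ 2) ^ 3) := by
  simp only [← Complex.normSq_eq_norm_sq, Complex.normSq_apply, Fin.sum_univ_four, phase]
  simp
  ring

/-- Fourth roots of unity no longer reproduce the uniform circle average here. With `u`, `v` the
real and imaginary parts of `y * conj a`, the term `u ^ 4 + v ^ 4` appears and is bounded by `(u ^ 2
+ v ^ 2) ^ 2`. -/
theorem sum_norm_add_phase_mul_pow_eight_le (y a : ℂ) :
    ∑ k, (‖y + phase k * a‖ ^ 2) ^ 4 ≤
      4 * ((‖y‖ ^ 2) ^ 4 + 16 * ((‖y‖ ^ 2) ^ 3 * ‖a‖ ^ 2) +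
        38 * ((‖y‖ ^ 2) ^ 2 * (‖a‖ ^ 2) ^ 2) + 16 * (‖y‖ ^ 2 * (‖a‖ ^ 2) ^ 3) +
        (‖a‖ ^ 2) ^ 4) := by
  simp only [← Complex.normSq_eq_norm_sq, Complex.normSq_apply, Fin.sum_univ_four, phase]
  simp
  nlinarith [sq_nonneg ((y.re * a.re + y.im * a.im) * (y.re * a.im - y.im * a.re))]

/-- The average of `f (∑ j, phase (ω j) * a j)` over uniformly random `ω`. -/
noncomputable def phaseAverage {d : ℕ} (a : Fin d → ℂ) (f : ℂ → ℝ) : ℝ :=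
  ((4 : ℝ) ^ d)⁻¹ * ∑ ω : Fin d → Fin 4, f (∑ j, phase (ω j) * a j)

theorem phaseAverage_zero (a : Fin 0 → ℂ) (f : ℂ → ℝ) : phaseAverage a f = f 0 := by
  simp [phaseAverage]

/-- Averaging over one phase with the rest of the sum frozen as `y` gives the recursion behind all
moment computations. -/
theorem phaseAverage_succ {d : ℕ} (a : Fin (d + 1) → ℂ) (f : ℂ → ℝ) :
    phaseAverage a f =
      phaseAverage (fun j => a j.succ) fun y => (∑ k, f (y + phase k * a 0)) / 4 := by
  simp only [phaseAverage]
  rw [← (Fin.consEquiv fun _ => Fin 4).sum_comp, Fintype.sum_prod_type, Finset.sum_comm, pow_succ,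
    mul_inv, mul_assoc, Finset.mul_sum (a := (4 : ℝ)⁻¹)]
  congr 1
  refine Finset.sum_congr rfl fun ω _ => ?_
  rw [div_eq_inv_mul]
  congr 1
  refine Finset.sum_congr rfl fun k _ => ?_
  simp [Fin.consEquiv, Fin.sum_univ_succ, add_comm]

section Linear

variable {d : ℕ} (a : Fin d → ℂ)

theorem phaseAverage_add (f g : ℂ → ℝ) :
    phaseAverage a (fun y => f y + g y) = phaseAverage a f + phaseAverage a g := by
  simp only [phaseAverage, Finset.sum_add_distrib, mul_add]

theorem phaseAverage_const_mul (c : ℝ) (f : ℂ → ℝ) :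
    phaseAverage a (fun y => c * f y) = c * phaseAverage a f := by
  simp only [phaseAverage, ← Finset.mul_sum]
  ring

theorem phaseAverage_mul_const (c : ℝ) (f : ℂ → ℝ) :
    phaseAverage a (fun y => f y * c) = phaseAverage a f * c := by
  simpa only [mul_comm] using phaseAverage_const_mul a c f

theorem phaseAverage_const (c : ℝ) : phaseAverage a (fun _ => c) = c := by
  simp [phaseAverage]

theorem phaseAverage_mono {f g : ℂ → ℝ} (h : ∀ y, f y ≤ g y) :
    phaseAverage a f ≤ phaseAverage a g :=
  mul_le_mul_of_nonneg_left (Finset.sum_le_sum fun _ _ => h _) (by positivity)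

end Linear

theorem phaseAverage_norm_pow_two {d : ℕ} (a : Fin d → ℂ) :
    phaseAverage a (fun y => ‖y‖ ^ 2) = ∑ j, ‖a j‖ ^ 2 := by
  induction d with
  | zero => simp [phaseAverage_zero]
  | succ d ih =>
    rw [phaseAverage_succ, Fin.sum_univ_succ]
    simp only [sum_norm_add_phase_mul_pow_two, mul_div_cancel_left₀ _ (four_ne_zero (α := ℝ)),
      phaseAverage_add, phaseAverage_const, ih]
    ring

theorem phaseAverage_norm_pow_four {d : ℕ} (a : Fin d → ℂ) :
    phaseAverage a (fun y => (‖y‖ ^ 2) ^ 2) =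
      2 * (∑ j, ‖a j‖ ^ 2) ^ 2 - ∑ j, (‖a j‖ ^ 2) ^ 2 := by
  induction d with
  | zero => simp [phaseAverage_zero]
  | succ d ih =>
    rw [phaseAverage_succ, Fin.sum_univ_succ, Fin.sum_univ_succ]
    simp only [sum_norm_add_phase_mul_pow_four, mul_div_cancel_left₀ _ (four_ne_zero (α := ℝ)),
      phaseAverage_add, phaseAverage_const_mul, phaseAverage_mul_const, phaseAverage_const, ih,
      phaseAverage_norm_pow_two]
    ring

/-- The constant `6 = 3!` is that of a complex Gaussian. The induction closes by comparing
coefficients, after dropping the negative term of the fourth moment. -/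
theorem phaseAverage_norm_pow_six_le {d : ℕ} (a : Fin d → ℂ) :
    phaseAverage a (fun y => (‖y‖ ^ 2) ^ 3) ≤ 6 * (∑ j, ‖a j‖ ^ 2) ^ 3 := by
  induction d with
  | zero => simp [phaseAverage_zero]
  | succ d ih =>
    rw [phaseAverage_succ, Fin.sum_univ_succ]
    simp only [sum_norm_add_phase_mul_pow_six, mul_div_cancel_left₀ _ (four_ne_zero (α := ℝ)),
      phaseAverage_add, phaseAverage_const_mul, phaseAverage_mul_const, phaseAverage_const,
      phaseAverage_norm_pow_two, phaseAverage_norm_pow_four]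
    have h3 := ih fun j => a j.succ
    have hS : 0 ≤ ∑ j, (‖a (Fin.succ j)‖ ^ 2) ^ 2 := by positivity
    have hσ : 0 ≤ ∑ j, ‖a (Fin.succ j)‖ ^ 2 := by positivity
    have hb : 0 ≤ ‖a 0‖ ^ 2 := by positivity
    generalize ‖a 0‖ ^ 2 = b at *
    generalize ∑ j, ‖a (Fin.succ j)‖ ^ 2 = σ at *
    generalize ∑ j, (‖a (Fin.succ j)‖ ^ 2) ^ 2 = S at *
    have e : 6 * (b + σ) ^ 3 = 6 * σ ^ 3 + 18 * (σ ^ 2 * b) + 18 * (σ * b ^ 2) + 6 * b ^ 3 := by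
      ring
    have := mul_nonneg hS hb
    have := mul_nonneg hσ (pow_nonneg hb 2)
    have := pow_nonneg hb 3
    linarith

theorem phaseAverage_norm_pow_eight_le {d : ℕ} (a : Fin d → ℂ) :
    phaseAverage a (fun y => (‖y‖ ^ 2) ^ 4) ≤ 24 * (∑ j, ‖a j‖ ^ 2) ^ 4 := by
  induction d with
  | zero => simp [phaseAverage_zero]
  | succ d ih =>
    rw [phaseAverage_succ, Fin.sum_univ_succ]
    refine (phaseAverage_mono _ fun y => div_le_div_of_nonneg_right
      (sum_norm_add_phase_mul_pow_eight_le y (a 0)) (by norm_num)).trans ?_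
    simp only [mul_div_cancel_left₀ _ (four_ne_zero (α := ℝ)),
      phaseAverage_add, phaseAverage_const_mul, phaseAverage_mul_const, phaseAverage_const,
      phaseAverage_norm_pow_two, phaseAverage_norm_pow_four]
    have h4 := ih fun j => a j.succ
    have h3 := phaseAverage_norm_pow_six_le fun j => a j.succ
    have hS : 0 ≤ ∑ j, (‖a (Fin.succ j)‖ ^ 2) ^ 2 := by positivity
    have hσ : 0 ≤ ∑ j, ‖a (Fin.succ j)‖ ^ 2 := by positivity
    have hb : 0 ≤ ‖a 0‖ ^ 2 := by positivity
    generalize ‖a 0‖ ^ 2 = b at *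
    generalize ∑ j, ‖a (Fin.succ j)‖ ^ 2 = σ at *
    generalize ∑ j, (‖a (Fin.succ j)‖ ^ 2) ^ 2 = S at *
    have e : 24 * (b + σ) ^ 4 = 24 * σ ^ 4 + 96 * (σ ^ 3 * b) + 144 * (σ ^ 2 * b ^ 2) +
        96 * (σ * b ^ 3) + 24 * b ^ 4 := by
      ring
    have := mul_le_mul_of_nonneg_right h3 hb
    have := mul_nonneg hS (pow_nonneg hb 2)
    have := mul_nonneg (pow_nonneg hσ 2) (pow_nonneg hb 2)
    have := mul_nonneg hσ (pow_nonneg hb 3)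
    have := pow_nonneg hb 4
    linarith

end QLearn

/-! ### The computational and twisted Walsh–Hadamard measurements -/

namespace QLearn

variable {n : ℕ}

/-- The measurement with the rank-one elements `|v s⟩⟨v s|`. -/
def rankOnePOVM {ι : Type} [Fintype ι] [DecidableEq ι] {k : ℕ} (v : Fin k → ι → ℂ)
    (h : ∑ s, Matrix.vecMulVec (v s) (star (v s)) = 1) : POVM ι k where
  elem := fun s => Matrix.vecMulVec (v s) (star (v s))
  posSemidef := fun _ => Matrix.posSemidef_vecMulVec_self_star _
  sum_eq_one := h

section RankOne

variable {ι : Type} [Fintype ι] [DecidableEq ι] {k : ℕ} (v : Fin k → ι → ℂ)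
  (h : ∑ s, Matrix.vecMulVec (v s) (star (v s)) = 1)

theorem outcomeProb_rankOnePOVM_density (ψ : PureState ι) (s : Fin k) :
    (rankOnePOVM v h).outcomeProb ψ.density s = ‖∑ t, star (v s t) * ψ.vec t‖ ^ 2 := by
  simp only [POVM.outcomeProb, rankOnePOVM, PureState.density, Matrix.vecMulVec_mul_vecMulVec,
    Matrix.vecMulVec_smul, Matrix.trace_smul, Matrix.trace_vecMulVec, smul_eq_mul]
  rw [← Complex.normSq_eq_norm_sq, ← Complex.ofReal_re (Complex.normSq _), ← Complex.mul_conj]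
  congr 2
  simp only [dotProduct, Pi.star_apply, map_sum, map_mul, Complex.star_def, Complex.conj_conj]

theorem outcomeProb_rankOnePOVM_maximallyMixed (s : Fin k) :
    (rankOnePOVM v h).outcomeProb (maximallyMixed ι) s =
      (Fintype.card ι : ℝ)⁻¹ * ∑ t, ‖v s t‖ ^ 2 := by
  simp only [POVM.outcomeProb, rankOnePOVM, maximallyMixed, Matrix.mul_smul, Matrix.mul_one,
    Matrix.trace_smul, Matrix.trace_vecMulVec, smul_eq_mul, dotProduct, Pi.star_apply,
    Complex.star_def, Complex.mul_conj, Complex.normSq_eq_norm_sq]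
  rw [← Complex.ofReal_sum, ← Complex.ofReal_natCast, ← Complex.ofReal_inv, ← Complex.ofReal_mul,
    Complex.ofReal_re]

end RankOne

/-- The numbering of the basis of `n` qubits. -/
def qubitsEquiv (n : ℕ) : Fin (2 ^ n) ≃ Qubits n := finFunctionFinEquiv.symm

/-- The measurement in the computational basis. -/
noncomputable def computationalPOVM (n : ℕ) : POVM (Qubits n) (2 ^ n) :=
  rankOnePOVM (fun s => Pi.single (qubitsEquiv n s) 1) <| by
    rw [(qubitsEquiv n).sum_comp fun s => Matrix.vecMulVec (Pi.single s (1 : ℂ))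
      (star (Pi.single s 1))]
    ext t t'
    simp [Matrix.sum_apply, Matrix.vecMulVec_apply, Pi.single_apply, Matrix.one_apply]

/-- The entries `±1` of the Walsh–Hadamard matrix. -/
noncomputable def walsh (s t : Qubits n) : ℂ := ∏ i, if s i = 1 ∧ t i = 1 then -1 else 1

theorem norm_walsh (s t : Qubits n) : ‖walsh s t‖ = 1 := by
  rw [walsh, norm_prod]
  exact Finset.prod_eq_one fun i _ => by split_ifs <;> simp

theorem star_walsh (s t : Qubits n) : star (walsh s t) = walsh s t := by
  rw [walsh, star_prod]
  exact Finset.prod_congr rfl fun i _ => by split_ifs <;> simp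

/-- The sum over bit strings factors into sums over single bits, and one differing bit makes its
factor vanish. -/
theorem sum_walsh_mul_walsh (t t' : Qubits n) :
    ∑ s, walsh s t * walsh s t' = if t = t' then 2 ^ n else 0 := by
  simp only [walsh, ← Finset.prod_mul_distrib]
  rw [← Fintype.prod_sum fun i (j : Fin 2) => (if j = 1 ∧ t i = 1 then (-1 : ℂ) else 1) *
    if j = 1 ∧ t' i = 1 then -1 else 1]
  have h : ∀ a b : Fin 2, ∑ j : Fin 2, (if j = 1 ∧ a = 1 then (-1 : ℂ) else 1) *
      (if j = 1 ∧ b = 1 then -1 else 1) = if a = b then 2 else 0 := by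
    intro a b
    fin_cases a <;> fin_cases b <;> norm_num
  simp only [h]
  split_ifs with ht
  · subst ht; simp
  · obtain ⟨i, hi⟩ := Function.ne_iff.1 ht
    exact Finset.prod_eq_zero (Finset.mem_univ i) (if_neg hi)

theorem phase_mul_star (k : Fin 4) : phase k * star (phase k) = 1 := by
  rw [Complex.star_def, Complex.mul_conj, Complex.normSq_eq_norm_sq, norm_phase]
  simp

/-- The Walsh–Hadamard basis, twisted by the phases `ω`. -/
noncomputable def walshVec (ω : Fin (2 ^ n) → Fin 4) (s : Fin (2 ^ n)) (t : Qubits n) : ℂ :=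
  ((√(2 ^ n))⁻¹ : ℝ) * walsh (qubitsEquiv n s) t * star (phase (ω ((qubitsEquiv n).symm t)))

theorem inv_sqrt_two_pow_sq (n : ℕ) : ((√(2 ^ n))⁻¹ : ℝ) ^ 2 = (2 ^ n)⁻¹ := by
  rw [inv_pow, Real.sq_sqrt (by positivity)]

theorem norm_walshVec_sq (ω : Fin (2 ^ n) → Fin 4) (s : Fin (2 ^ n)) (t : Qubits n) :
    ‖walshVec ω s t‖ ^ 2 = (2 ^ n)⁻¹ := by
  rw [walshVec, norm_mul, norm_mul, norm_walsh, norm_star, norm_phase, mul_one, mul_one,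
    Complex.norm_real, Real.norm_eq_abs, sq_abs, inv_sqrt_two_pow_sq]

/-- The measurement in the twisted Walsh–Hadamard basis. -/
noncomputable def walshPOVM (ω : Fin (2 ^ n) → Fin 4) : POVM (Qubits n) (2 ^ n) :=
  rankOnePOVM (walshVec ω) <| by
    ext t t'
    have h : ∀ s, walshVec ω s t * star (walshVec ω s t') =
        (2 ^ n : ℂ)⁻¹ * (walsh (qubitsEquiv n s) t * walsh (qubitsEquiv n s) t') *
          (phase (ω ((qubitsEquiv n).symm t')) * star (phase (ω ((qubitsEquiv n).symm t)))) := by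
      intro s
      have h2 : (2 ^ n : ℂ)⁻¹ = (((√(2 ^ n))⁻¹ : ℝ) : ℂ) ^ 2 := by
        rw [← Complex.ofReal_pow, inv_sqrt_two_pow_sq]; simp
      rw [walshVec, walshVec, star_mul, star_mul, star_star, star_walsh, Complex.star_def,
        Complex.conj_ofReal, h2]
      ring
    simp only [Matrix.sum_apply, Matrix.vecMulVec_apply, Pi.star_apply, h]
    rw [← Finset.sum_mul, ← Finset.mul_sum,
      (qubitsEquiv n).sum_comp fun s => walsh s t * walsh s t', sum_walsh_mul_walsh,
      Matrix.one_apply]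
    split_ifs with ht
    · subst ht
      rw [phase_mul_star, mul_one, inv_mul_cancel₀ (by positivity)]
    · simp

theorem card_qubits (n : ℕ) : Fintype.card (Qubits n) = 2 ^ n := by simp

theorem outcomeProb_computationalPOVM_maximallyMixed (s : Fin (2 ^ n)) :
    (computationalPOVM n).outcomeProb (maximallyMixed (Qubits n)) s = (2 ^ n)⁻¹ := by
  rw [computationalPOVM, outcomeProb_rankOnePOVM_maximallyMixed, card_qubits,
    Finset.sum_eq_single (qubitsEquiv n s)]
  · simp
  · intro b _ hb
    simp [hb]
  · simp

theorem outcomeProb_walshPOVM_maximallyMixed (ω : Fin (2 ^ n) → Fin 4) (s : Fin (2 ^ n)) :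
    (walshPOVM ω).outcomeProb (maximallyMixed (Qubits n)) s = (2 ^ n)⁻¹ := by
  rw [walshPOVM, outcomeProb_rankOnePOVM_maximallyMixed]
  simp [norm_walshVec_sq]

theorem powerSum_of_outcomeProb_eq {F : POVM (Qubits n) (2 ^ n)} {ρ : Op (Qubits n)}
    (h : ∀ s, F.outcomeProb ρ s = (2 ^ n)⁻¹) (r : ℕ) : F.powerSum ρ (r + 1) = (2 ^ n)⁻¹ ^ r := by
  simp only [POVM.powerSum, h, Finset.sum_const, Finset.card_univ, Fintype.card_fin, nsmul_eq_mul]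
  push_cast
  rw [pow_succ', mul_inv_cancel_left₀ (by positivity)]

theorem outcomeProb_computationalPOVM_density (ψ : PureState (Qubits n)) (s : Fin (2 ^ n)) :
    (computationalPOVM n).outcomeProb ψ.density s = ‖ψ.vec (qubitsEquiv n s)‖ ^ 2 := by
  rw [computationalPOVM, outcomeProb_rankOnePOVM_density, Finset.sum_eq_single (qubitsEquiv n s)]
  · simp
  · intro b _ hb
    simp [hb]
  · simp

/-- The coefficients of the phases in the amplitude of an outcome of a twisted Walsh–Hadamard
measurement. -/
noncomputable def walshCoeff (ψ : PureState (Qubits n)) (s j : Fin (2 ^ n)) : ℂ :=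
  walsh (qubitsEquiv n s) (qubitsEquiv n j) * ψ.vec (qubitsEquiv n j)

theorem norm_walshCoeff (ψ : PureState (Qubits n)) (s j : Fin (2 ^ n)) :
    ‖walshCoeff ψ s j‖ = ‖ψ.vec (qubitsEquiv n j)‖ := by
  rw [walshCoeff, norm_mul, norm_walsh, one_mul]

theorem outcomeProb_walshPOVM_density (ω : Fin (2 ^ n) → Fin 4) (ψ : PureState (Qubits n))
    (s : Fin (2 ^ n)) :
    (walshPOVM ω).outcomeProb ψ.density s =
      (2 ^ n)⁻¹ * ‖∑ j, phase (ω j) * walshCoeff ψ s j‖ ^ 2 := by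
  have h : ∑ t, star (walshVec ω s t) * ψ.vec t =
      (((√(2 ^ n))⁻¹ : ℝ) : ℂ) * ∑ j, phase (ω j) * walshCoeff ψ s j := by
    rw [← (qubitsEquiv n).sum_comp, Finset.mul_sum]
    refine Finset.sum_congr rfl fun j _ => ?_
    rw [walshVec, star_mul, star_mul, star_star, star_walsh, Complex.star_def, Complex.conj_ofReal,
      Equiv.symm_apply_apply, walshCoeff]
    ring
  rw [walshPOVM, outcomeProb_rankOnePOVM_density, h, norm_mul, mul_pow, Complex.norm_real,
    Real.norm_eq_abs, sq_abs, inv_sqrt_two_pow_sq]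

theorem sum_norm_qubitsEquiv_sq (ψ : PureState (Qubits n)) :
    ∑ j, ‖ψ.vec (qubitsEquiv n j)‖ ^ 2 = 1 := by
  rw [(qubitsEquiv n).sum_comp fun t => ‖ψ.vec t‖ ^ 2, ψ.normalized]

section Average

variable (ψ : PureState (Qubits n))

theorem average_sum_outcomeProb_walshPOVM (r : ℕ) :
    (Fintype.card (Fin (2 ^ n) → Fin 4) : ℝ)⁻¹ * ∑ ω, (walshPOVM ω).powerSum ψ.density r =
      (2 ^ n)⁻¹ ^ r * ∑ s, phaseAverage (walshCoeff ψ s) fun y => (‖y‖ ^ 2) ^ r := by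
  simp only [POVM.powerSum, outcomeProb_walshPOVM_density, mul_pow _ _ r, phaseAverage]
  rw [Finset.sum_comm]
  simp only [← Finset.mul_sum, Fintype.card_fun, Fintype.card_fin]
  push_cast
  ring

/-- Walsh entries have modulus one, so every outcome has the same fourth moment `2 - S`. The deficit
`S` is the computational collision probability, which is why adding that basis helps. -/
theorem average_powerSum_two_walshPOVM :
    (Fintype.card (Fin (2 ^ n) → Fin 4) : ℝ)⁻¹ * ∑ ω, (walshPOVM ω).powerSum ψ.density 2 =
      (2 ^ n)⁻¹ * (2 - (computationalPOVM n).powerSum ψ.density 2) := by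
  rw [average_sum_outcomeProb_walshPOVM]
  simp only [phaseAverage_norm_pow_four, norm_walshCoeff, sum_norm_qubitsEquiv_sq, POVM.powerSum,
    outcomeProb_computationalPOVM_density, Finset.sum_const, Finset.card_univ, Fintype.card_fin,
    nsmul_eq_mul]
  push_cast
  field_simp

theorem average_powerSum_three_walshPOVM_le :
    (Fintype.card (Fin (2 ^ n) → Fin 4) : ℝ)⁻¹ * ∑ ω, (walshPOVM ω).powerSum ψ.density 3 ≤
      6 * (2 ^ n)⁻¹ ^ 2 := by
  rw [average_sum_outcomeProb_walshPOVM]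
  have h : ∀ s, phaseAverage (walshCoeff ψ s) (fun y => (‖y‖ ^ 2) ^ 3) ≤ 6 := fun s => by
    simpa [norm_walshCoeff, sum_norm_qubitsEquiv_sq] using
      phaseAverage_norm_pow_six_le (walshCoeff ψ s)
  calc _ ≤ ((2 : ℝ) ^ n)⁻¹ ^ 3 * ∑ _s : Fin (2 ^ n), (6 : ℝ) :=
        mul_le_mul_of_nonneg_left (Finset.sum_le_sum fun s _ => h s) (by positivity)
    _ = _ := by
      simp only [Finset.sum_const, Finset.card_univ, Fintype.card_fin, nsmul_eq_mul]
      push_cast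
      field_simp

/-- Cauchy–Schwarz over the `2 ^ n` outcomes reduces the squared collision probability to the eighth
moment of the amplitudes. -/
theorem average_powerSum_two_sq_walshPOVM_le :
    (Fintype.card (Fin (2 ^ n) → Fin 4) : ℝ)⁻¹ * ∑ ω, (walshPOVM ω).powerSum ψ.density 2 ^ 2 ≤
      24 * (2 ^ n)⁻¹ ^ 2 := by
  have h : ∀ s, phaseAverage (walshCoeff ψ s) (fun y => (‖y‖ ^ 2) ^ 4) ≤ 24 := fun s => by
    simpa [norm_walshCoeff, sum_norm_qubitsEquiv_sq] using
      phaseAverage_norm_pow_eight_le (walshCoeff ψ s)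
  have h2 : ∀ ω, (walshPOVM ω).powerSum ψ.density 2 ^ 2 ≤
      2 ^ n * (walshPOVM ω).powerSum ψ.density 4 := fun ω => by
    have := sq_sum_le_card_mul_sum_sq (s := Finset.univ)
      (f := fun s => (walshPOVM ω).outcomeProb ψ.density s ^ 2)
    simpa [POVM.powerSum, ← pow_mul] using this
  calc _ ≤ (Fintype.card (Fin (2 ^ n) → Fin 4) : ℝ)⁻¹ *
        ∑ ω, 2 ^ n * (walshPOVM ω).powerSum ψ.density 4 :=
        mul_le_mul_of_nonneg_left (Finset.sum_le_sum fun ω _ => h2 ω) (by positivity)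
    _ = 2 ^ n * ((2 ^ n)⁻¹ ^ 4 * ∑ s, phaseAverage (walshCoeff ψ s) fun y => (‖y‖ ^ 2) ^ 4) := by
      rw [← Finset.mul_sum, mul_left_comm, average_sum_outcomeProb_walshPOVM]
    _ ≤ 2 ^ n * (((2 : ℝ) ^ n)⁻¹ ^ 4 * ∑ _s : Fin (2 ^ n), (24 : ℝ)) := by
      gcongr with s
      exact h s
    _ = _ := by
      simp only [Finset.sum_const, Finset.card_univ, Fintype.card_fin, nsmul_eq_mul]
      push_cast
      field_simp

end Average

end QLearn

/-! ### Thresholding the sum of repeated rounds -/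

namespace QLearn

/-- Repeat a learner `m` times and compare the sum of the answers with `m * τ`. -/
noncomputable def StateLearner.threshold {n S : ℕ} (A : StateLearner n ℝ S) (m : ℕ) (τ : ℝ) :
    StateLearner n Bool (S * m) :=
  (A.sumIid m).map fun a => decide (m * τ ≤ a)

section Threshold

variable {n S : ℕ} {ρ : Op (Qubits n)} (A : StateLearner n ℝ S) {m : ℕ} {τ c t V : ℝ}

/-- The sum has variance at most `m * V`, so a deviation `m * t` has probability at most `V / (m * t
^ 2) ≤ 1 / 3`. -/
theorem ev_sumIid_tail_le (hρ : IsDensity ρ) (hm : 0 < m) (ht : 0 < t)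
    (hV : A.ev ρ (fun a => (a - c) ^ 2) ≤ V) (hVt : 3 * V ≤ m * t ^ 2) {P : ℝ → Prop}
    [DecidablePred P] (hP : ∀ a, P a → m * t ≤ |a - m * A.ev ρ id|) :
    (A.sumIid m).ev ρ (fun a => if P a then 1 else 0) ≤ 1 / 3 := by
  have hm' : (0 : ℝ) < m := by exact_mod_cast hm
  have hmt : 0 < m * t := mul_pos hm' ht
  refine (StateLearner.ev_indicator_le hρ (A.sumIid m) (fun a => a - m * A.ev ρ id) hmt
    fun a ha => ?_).trans ?_
  · rw [← sq_abs (a - _)]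
    exact pow_le_pow_left₀ hmt.le (hP a ha) 2
  · rw [div_le_iff₀ (by positivity)]
    have h1 := StateLearner.ev_sumIid_sub_sq_le hρ A m c
    have h2 := mul_le_mul_of_nonneg_left hV hm'.le
    have h3 := mul_le_mul_of_nonneg_left hVt hm'.le
    nlinarith

theorem prob_threshold_true (hρ : IsDensity ρ) (hm : 0 < m) (ht : 0 < t)
    (hV : A.ev ρ (fun a => (a - c) ^ 2) ≤ V) (hVt : 3 * V ≤ m * t ^ 2) (hτ : τ + t ≤ A.ev ρ id) :
    2 / 3 ≤ (A.threshold m τ).prob ρ true := by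
  have h := ev_sumIid_tail_le A hρ hm ht hV hVt (P := fun a => ¬ m * τ ≤ a) fun a ha => by
    have := mul_le_mul_of_nonneg_left hτ (Nat.cast_nonneg (α := ℝ) m)
    rw [abs_sub_comm]
    exact le_trans (by linarith) (le_abs_self _)
  have h1 : (A.threshold m τ).prob ρ true + (A.sumIid m).ev ρ
      (fun a => if ¬ m * τ ≤ a then 1 else 0) = 1 := by
    rw [StateLearner.prob_eq_ev, StateLearner.threshold, StateLearner.ev_map, ← StateLearner.ev_add]
    refine Eq.trans ?_ (StateLearner.ev_const hρ (A.sumIid m) 1)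
    congr 1; ext a
    by_cases ha : m * τ ≤ a <;> simp [ha]
  linarith

theorem prob_threshold_false (hρ : IsDensity ρ) (hm : 0 < m) (ht : 0 < t)
    (hV : A.ev ρ (fun a => (a - c) ^ 2) ≤ V) (hVt : 3 * V ≤ m * t ^ 2) (hτ : A.ev ρ id ≤ τ - t) :
    2 / 3 ≤ (A.threshold m τ).prob ρ false := by
  have h := ev_sumIid_tail_le A hρ hm ht hV hVt (P := fun a => m * τ ≤ a) fun a ha => by
    have := mul_le_mul_of_nonneg_left hτ (Nat.cast_nonneg (α := ℝ) m)
    exact le_trans (by linarith) (le_abs_self _)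
  have h1 : (A.threshold m τ).prob ρ false + (A.sumIid m).ev ρ
      (fun a => if m * τ ≤ a then 1 else 0) = 1 := by
    rw [StateLearner.prob_eq_ev, StateLearner.threshold, StateLearner.ev_map, ← StateLearner.ev_add]
    refine Eq.trans ?_ (StateLearner.ev_const hρ (A.sumIid m) 1)
    congr 1; ext a
    by_cases ha : m * τ ≤ a <;> simp [ha]
  linarith

end Threshold

/-! ### From state learners to channel learners -/

section ZeroInput

variable {n : ℕ}

theorem ampliate_density_basis (C : Channel (Qubits n)) :
    ampliate C.map (PureState.basis ((0, 0) : Qubits n × Qubits 0)).density =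
      (C.map (PureState.basis (0 : Qubits n)).density).submatrix
        (Equiv.prodUnique (Qubits n) (Qubits 0)) (Equiv.prodUnique (Qubits n) (Qubits 0)) := by
  ext ⟨i, a⟩ ⟨j, b⟩
  rw [Subsingleton.elim a 0, Subsingleton.elim b 0]
  have h : (Matrix.of fun i j =>
      (PureState.basis ((0, 0) : Qubits n × Qubits 0)).density (i, 0) (j, 0)) =
      (PureState.basis (0 : Qubits n)).density := by
    ext i j
    simp [PureState.density, PureState.basis, Matrix.vecMulVec_apply, Pi.single_apply]
  simp only [ampliate, Matrix.of_apply, h]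
  rfl

theorem outcomeProb_reindex {ι κ : Type} [Fintype ι] [Fintype κ] [DecidableEq ι] [DecidableEq κ]
    {k : ℕ} (e : κ ≃ ι) (F : POVM ι k) (ρ : Op ι) (s : Fin k) :
    (F.reindex e).outcomeProb (ρ.submatrix e e) s = F.outcomeProb ρ s := by
  simp only [POVM.outcomeProb, POVM.reindex, Matrix.submatrix_mul_equiv]
  congr 1
  exact e.sum_comp fun i => (F.elem s * ρ) i i

theorem prob_onZeroInput {α : Type} [DecidableEq α] (C : Channel (Qubits n)) (b : α) {T : ℕ}
    (A : StateLearner n α T) :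
    A.onZeroInput.prob C b = A.prob (C.map (PureState.basis 0).density) b := by
  induction A with
  | answer a => rfl
  | measure F next ih =>
    simp only [StateLearner.onZeroInput, ChannelLearner.prob, StateLearner.prob,
      ampliate_density_basis, outcomeProb_reindex, ih]

theorem continuous_prob {α : Type} [DecidableEq α] (b : α) {T : ℕ} (A : StateLearner n α T) :
    Continuous fun ρ => A.prob ρ b := by
  induction A with
  | answer a => exact continuous_const
  | measure F next ih =>
    refine continuous_finsetSum _ fun s _ => Continuous.mul ?_ (ih s)
    exact Complex.continuous_re.comp (continuous_const.matrix_mul continuous_id).matrix_trace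

theorem exists_density_eq_unitaryChannel {ι : Type} [Fintype ι] [DecidableEq ι]
    (U : Matrix.unitaryGroup ι ℂ) (ψ : PureState ι) :
    ∃ φ : PureState ι, φ.density = (unitaryChannel U).map ψ.density := by
  have h : Matrix.vecMulVec ((U : Op ι) *ᵥ ψ.vec) (star ((U : Op ι) *ᵥ ψ.vec)) =
      (unitaryChannel U).map ψ.density := by
    change _ = (U : Op ι) * Matrix.vecMulVec ψ.vec (star ψ.vec) * (U : Op ι)ᴴ
    rw [Matrix.mul_vecMulVec, Matrix.vecMulVec_mul, Matrix.star_mulVec]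
  refine ⟨⟨(U : Op ι) *ᵥ ψ.vec, ?_⟩, h⟩
  have h1 := congrArg Matrix.trace h
  rw [(unitaryChannel U).tracePreserving, ψ.isDensity.trace_eq_one, Matrix.trace_vecMulVec] at h1
  simp only [dotProduct, Pi.star_apply, Complex.star_def, Complex.mul_conj,
    Complex.normSq_eq_norm_sq] at h1
  exact_mod_cast h1

theorem distinguishes_onZeroInput_of_isPurityTester {T : ℕ} {A : StateLearner n Bool T}
    (hA : IsPurityTester A) : DistinguishesHaarUnitaryFromDepolarizing A.onZeroInput := by
  constructor
  · have hprob : IsProbabilityMeasure (haarUnitary (Qubits n)) :=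
      ⟨by simpa [haarUnitary] using
        Measure.haarMeasure_self (K₀ := (⊤ : TopologicalSpace.PositiveCompacts
          (Matrix.unitaryGroup (Qubits n) ℂ)))⟩
    have hc : Continuous fun U : Matrix.unitaryGroup (Qubits n) ℂ =>
        A.onZeroInput.prob (unitaryChannel U) true := by
      simp only [prob_onZeroInput]
      refine (continuous_prob true A).comp ?_
      change Continuous fun U : Matrix.unitaryGroup (Qubits n) ℂ =>
        (U : Op (Qubits n)) * (PureState.basis 0).density * (U : Op (Qubits n))ᴴ
      exact (continuous_subtype_val.matrix_mul continuous_const).matrix_mul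
        continuous_subtype_val.matrix_conjTranspose
    -- Continuity suffices because the unitary group is compact.
    have hint : Integrable (fun U => A.onZeroInput.prob (unitaryChannel U) true)
        (haarUnitary (Qubits n)) :=
      hc.integrable_of_hasCompactSupport (HasCompactSupport.of_compactSpace _)
    calc (2 / 3 : ℝ) = ∫ _, 2 / 3 ∂(haarUnitary (Qubits n)) := by simp
      _ ≤ _ := integral_mono (integrable_const _) hint fun U => by
        obtain ⟨φ, hφ⟩ := exists_density_eq_unitaryChannel U (PureState.basis (0 : Qubits n))
        simp only [prob_onZeroInput, ← hφ]
        exact hA.1 φ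
  · rw [prob_onZeroInput]
    have h : (depolarizingChannel (Qubits n)).map (PureState.basis 0).density =
        maximallyMixed (Qubits n) := by
      change (PureState.basis (0 : Qubits n)).density.trace • maximallyMixed (Qubits n) = _
      rw [(PureState.isDensity _).trace_eq_one, one_smul]
    rw [h]
    exact hA.2

end ZeroInput

end QLearn

/-! ### Parameters and correctness of the purity tester -/

namespace QLearn

variable {n : ℕ}

/-- The size of a batch of measurements in one round of the purity tester. -/
def batchSize (n : ℕ) : ℕ := 2 ^ ((n + 1) / 2)

/-- The exponent `(n + 1) / 2` is `n / 2` rounded up, so the square is `2 ^ n` or `2 ^ (n + 1)`. -/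
theorem le_batchSize_sq (n : ℕ) : (2 : ℝ) ^ n ≤ (batchSize n : ℝ) ^ 2 := by
  rw [batchSize, Nat.cast_pow, ← pow_mul]
  exact pow_le_pow_right₀ (by norm_num) (by omega)

theorem batchSize_sq_le (n : ℕ) : (batchSize n : ℝ) ^ 2 ≤ 2 * 2 ^ n := by
  rw [batchSize, Nat.cast_pow, ← pow_mul, ← pow_succ']
  exact pow_le_pow_right₀ (by norm_num) (by omega)

theorem one_le_batchSize (n : ℕ) : (1 : ℝ) ≤ batchSize n := by
  exact_mod_cast Nat.one_le_two_pow

theorem batchSize_le (n : ℕ) : (batchSize n : ℝ) ≤ 2 * (2 : ℝ) ^ ((n : ℝ) / 2) := by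
  refine (sq_le_sq₀ (by positivity) (by positivity)).1 ((batchSize_sq_le n).trans ?_)
  rw [mul_pow, ← Real.rpow_natCast (_ ^ (_ / _)), ← Real.rpow_mul (by norm_num)]
  have : (2 : ℝ) ^ ((n : ℝ) / 2 * (2 : ℕ)) = 2 ^ n := by
    rw [← Real.rpow_natCast]; congr 1; push_cast; ring
  rw [this]
  have : (0 : ℝ) < 2 ^ n := by positivity
  linarith

theorem batchSize_sq_mul_inv_le (n : ℕ) : (batchSize n : ℝ) ^ 2 * (2 ^ n)⁻¹ ≤ 2 := by
  rw [mul_inv_le_iff₀ (by positivity)]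
  exact batchSize_sq_le n

theorem batchSize_pow_four_mul_le (n : ℕ) : (batchSize n : ℝ) ^ 4 * (2 ^ n)⁻¹ ^ 2 ≤ 4 := by
  calc (batchSize n : ℝ) ^ 4 * (2 ^ n)⁻¹ ^ 2 = ((batchSize n : ℝ) ^ 2 * (2 ^ n)⁻¹) ^ 2 := by ring
    _ ≤ 2 ^ 2 := pow_le_pow_left₀ (by positivity) (batchSize_sq_mul_inv_le n) 2
    _ = 4 := by norm_num

theorem batchSize_pow_three_mul_le (n : ℕ) : (batchSize n : ℝ) ^ 3 * (2 ^ n)⁻¹ ^ 2 ≤ 4 :=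
  (mul_le_mul_of_nonneg_right (pow_le_pow_right₀ (one_le_batchSize n) (by norm_num))
    (by positivity)).trans (batchSize_pow_four_mul_le n)

/-- One round of the purity tester. -/
noncomputable def purityRound (n : ℕ) :=
  StateLearner.collisionRound (fun ω : Fin (2 ^ n) → Fin 4 => walshPOVM ω) (computationalPOVM n)
    (batchSize n)

section MaximallyMixed

theorem ev_purityRound_maximallyMixed :
    (purityRound n).ev (maximallyMixed (Qubits n)) id =
      2 * ((batchSize n : ℝ) ^ 2 * (2 ^ n)⁻¹) := by
  have h : (Fintype.card (Fin (2 ^ n) → Fin 4) : ℝ) ≠ 0 := by exact_mod_cast Fintype.card_ne_zero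
  rw [purityRound, StateLearner.ev_collisionRound _ _ _ maximallyMixed_isDensity]
  simp only [powerSum_of_outcomeProb_eq (outcomeProb_walshPOVM_maximallyMixed _) 1,
    powerSum_of_outcomeProb_eq outcomeProb_computationalPOVM_maximallyMixed 1, pow_one,
    Finset.sum_const, Finset.card_univ, nsmul_eq_mul, inv_mul_cancel_left₀ h]
  ring

theorem ev_collisions_maximallyMixed_le {F : POVM (Qubits n) (2 ^ n)}
    (h : ∀ s, F.outcomeProb (maximallyMixed (Qubits n)) s = (2 ^ n)⁻¹) :
    (StateLearner.collisions F (batchSize n)).ev (maximallyMixed (Qubits n))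
      (fun a => (a - batchSize n ^ 2 * (2 ^ n)⁻¹) ^ 2) ≤ 10 := by
  have h1 := StateLearner.ev_collisions_variance_le maximallyMixed_isDensity F (batchSize n)
  rw [powerSum_of_outcomeProb_eq h 1, powerSum_of_outcomeProb_eq h 2, pow_one] at h1
  -- The bound is `10 = 2 + 2 * 4`.
  have := batchSize_sq_mul_inv_le n
  have := batchSize_pow_three_mul_le n
  linarith

theorem ev_purityRound_maximallyMixed_sub_sq_le :
    (purityRound n).ev (maximallyMixed (Qubits n)) (fun a =>
      (a - (batchSize n ^ 2 * (2 ^ n)⁻¹ + batchSize n ^ 2 * (2 ^ n)⁻¹)) ^ 2) ≤ 40 := by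
  have h : (Fintype.card (Fin (2 ^ n) → Fin 4) : ℝ) ≠ 0 := by exact_mod_cast Fintype.card_ne_zero
  refine (StateLearner.ev_collisionRound_sub_sq_le _ _ _ maximallyMixed_isDensity _ _).trans ?_
  have h1 := ev_collisions_maximallyMixed_le
    (n := n) outcomeProb_computationalPOVM_maximallyMixed
  have h2 := mul_le_mul_of_nonneg_left (Finset.sum_le_sum
    fun (ω : Fin (2 ^ n) → Fin 4) (_ : ω ∈ Finset.univ) =>
      ev_collisions_maximallyMixed_le (outcomeProb_walshPOVM_maximallyMixed ω))
    (inv_nonneg.2 (Nat.cast_nonneg (α := ℝ) (Fintype.card (Fin (2 ^ n) → Fin 4))))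
  rw [Finset.sum_const, Finset.card_univ, nsmul_eq_mul, inv_mul_cancel_left₀ h] at h2
  linarith

end MaximallyMixed

section Pure

variable (ψ : PureState (Qubits n))

theorem ev_purityRound_density :
    (purityRound n).ev ψ.density id =
      batchSize n ^ 2 * ((2 ^ n)⁻¹ * (2 - (computationalPOVM n).powerSum ψ.density 2)) +
        batchSize n ^ 2 * (computationalPOVM n).powerSum ψ.density 2 := by
  rw [purityRound, StateLearner.ev_collisionRound _ _ _ ψ.isDensity,
    average_powerSum_two_walshPOVM]

theorem one_le_batchSize_sq_mul_powerSum (F : POVM (Qubits n) (2 ^ n)) :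
    1 ≤ (batchSize n : ℝ) ^ 2 * F.powerSum ψ.density 2 := by
  have h := sq_sum_le_card_mul_sum_sq (s := Finset.univ)
    (f := fun s => F.outcomeProb ψ.density s)
  rw [F.sum_outcomeProb ψ.isDensity, Finset.card_univ, Fintype.card_fin, one_pow] at h
  push_cast at h
  refine h.trans (mul_le_mul_of_nonneg_right (le_batchSize_sq n) ?_)
  exact Finset.sum_nonneg fun s _ => sq_nonneg _

/-- With `G = B ^ 2 * powerSum 2 ≥ 1`, each `B * p s` is at most `√G ≤ G`, so one factor of the cube
can be replaced by `G`. -/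
theorem batchSize_pow_three_mul_powerSum_le (F : POVM (Qubits n) (2 ^ n)) :
    (batchSize n : ℝ) ^ 3 * F.powerSum ψ.density 3 ≤
      (batchSize n ^ 2 * F.powerSum ψ.density 2) ^ 2 := by
  have h1 := one_le_batchSize_sq_mul_powerSum ψ F
  have h0 : ∀ s, 0 ≤ (batchSize n : ℝ) * F.outcomeProb ψ.density s := fun s =>
    mul_nonneg (Nat.cast_nonneg _) (F.outcomeProb_nonneg ψ.isDensity s)
  have hq : ∀ s, batchSize n * F.outcomeProb ψ.density s ≤
      batchSize n ^ 2 * F.powerSum ψ.density 2 := fun s => by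
    refine (sq_le_sq₀ (h0 s) (by linarith)).1 ?_
    have h2 : F.outcomeProb ψ.density s ^ 2 ≤ F.powerSum ψ.density 2 :=
      Finset.single_le_sum (f := fun s => F.outcomeProb ψ.density s ^ 2)
        (fun s _ => sq_nonneg _) (Finset.mem_univ s)
    have h3 := mul_le_mul_of_nonneg_left h2 (sq_nonneg (batchSize n : ℝ))
    rw [mul_pow]
    nlinarith
  calc (batchSize n : ℝ) ^ 3 * F.powerSum ψ.density 3
      = ∑ s, (batchSize n * F.outcomeProb ψ.density s) ^ 2 *
          (batchSize n * F.outcomeProb ψ.density s) := by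
        rw [POVM.powerSum, Finset.mul_sum]
        exact Finset.sum_congr rfl fun s _ => by ring
    _ ≤ ∑ s, (batchSize n * F.outcomeProb ψ.density s) ^ 2 *
          (batchSize n ^ 2 * F.powerSum ψ.density 2) :=
        Finset.sum_le_sum fun s _ => mul_le_mul_of_nonneg_left (hq s) (sq_nonneg _)
    _ = _ := by
        rw [← Finset.sum_mul, sq (_ * F.powerSum _ _)]
        simp only [mul_pow, ← Finset.mul_sum, POVM.powerSum]

/-- Since the mean count is bounded, the second moment about zero is good enough. The three terms
give `4 + 48 + 96 = 148`. -/
theorem average_ev_collisions_walshPOVM_le :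
    (Fintype.card (Fin (2 ^ n) → Fin 4) : ℝ)⁻¹ * ∑ ω,
      (StateLearner.collisions (walshPOVM ω) (batchSize n)).ev ψ.density (fun a => (a - 0) ^ 2) ≤
        148 := by
  simp only [sub_zero]
  refine (mul_le_mul_of_nonneg_left (Finset.sum_le_sum fun ω _ =>
    StateLearner.ev_collisions_sq_le ψ.isDensity (walshPOVM ω) (batchSize n))
      (by positivity)).trans ?_
  have hS : 0 ≤ (computationalPOVM n).powerSum ψ.density 2 :=
    Finset.sum_nonneg fun s _ => sq_nonneg _
  have h2 := average_powerSum_two_walshPOVM ψ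
  have h3 := mul_le_mul_of_nonneg_left (average_powerSum_three_walshPOVM_le ψ)
    (pow_nonneg (Nat.cast_nonneg (α := ℝ) (batchSize n)) 3)
  have h4 := mul_le_mul_of_nonneg_left (average_powerSum_two_sq_walshPOVM_le ψ)
    (pow_nonneg (Nat.cast_nonneg (α := ℝ) (batchSize n)) 4)
  have b2 := batchSize_sq_mul_inv_le n
  have b3 := batchSize_pow_three_mul_le n
  have b4 := batchSize_pow_four_mul_le n
  have b0 : 0 ≤ (batchSize n : ℝ) ^ 2 * (2 ^ n)⁻¹ := by positivity
  have b5 := mul_nonneg b0 hS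
  simp only [Finset.sum_add_distrib, ← Finset.mul_sum, mul_add, mul_left_comm _ ((_ : ℝ) ^ _),
    mul_left_comm _ (2 * (_ : ℝ) ^ _), h2]
  linarith

theorem ev_purityRound_density_sub_sq_le :
    (purityRound n).ev ψ.density (fun a =>
      (a - (0 + batchSize n ^ 2 * (computationalPOVM n).powerSum ψ.density 2)) ^ 2) ≤
        302 * (batchSize n ^ 2 * (computationalPOVM n).powerSum ψ.density 2) ^ 2 := by
  refine (StateLearner.ev_collisionRound_sub_sq_le _ _ _ ψ.isDensity _ _).trans ?_
  have h1 := average_ev_collisions_walshPOVM_le ψ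
  have h2 := StateLearner.ev_collisions_variance_le ψ.isDensity (computationalPOVM n) (batchSize n)
  have h3 := batchSize_pow_three_mul_powerSum_le ψ (computationalPOVM n)
  have h4 := one_le_batchSize_sq_mul_powerSum ψ (computationalPOVM n)
  -- With `G` the mean computational count, `2 * 148 + 2 * (G + 2 * G ^ 2) ≤ 302 * G ^ 2` because `G
  -- ≥ 1`.
  nlinarith

end Pure

/-- The purity tester. -/
noncomputable def purityTester (n : ℕ) :=
  (purityRound n).threshold 15000 (2 * ((batchSize n : ℝ) ^ 2 * (2 ^ n)⁻¹) + 1 / 4)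

theorem isPurityTester_purityTester (hn : 1 ≤ n) : IsPurityTester (purityTester n) := by
  constructor
  · intro ψ
    have hG := one_le_batchSize_sq_mul_powerSum ψ (computationalPOVM n)
    refine prob_threshold_true (purityRound n) ψ.isDensity (by norm_num)
      (t := batchSize n ^ 2 * (computationalPOVM n).powerSum ψ.density 2 / 4) (by linarith)
      (ev_purityRound_density_sub_sq_le ψ) ?_ ?_
    · push_cast
      nlinarith
    · rw [ev_purityRound_density]
      -- The margin: `G - G / 2 ^ n ≥ G / 2 ≥ 1 / 4 + G / 4`, using `n ≥ 1` and then `G ≥ 1`.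
      have hd : ((2 : ℝ) ^ n)⁻¹ ≤ 1 / 2 := by
        rw [inv_le_comm₀ (by positivity) (by norm_num)]
        simpa using pow_le_pow_right₀ (one_le_two (α := ℝ)) hn
      have := mul_le_mul_of_nonneg_right hd (zero_le_one.trans hG)
      nlinarith
  · refine prob_threshold_false (purityRound n) maximallyMixed_isDensity (by norm_num)
      (t := 1 / 4) (by norm_num) ev_purityRound_maximallyMixed_sub_sq_le ?_ ?_
    · norm_num
    · rw [ev_purityRound_maximallyMixed]
      linarith

end QLearn

theorem mainTheorem12 :
    ∃ c : ℝ, 0 < c ∧ ∀ n : ℕ, 1 ≤ n →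
      ∃ T : ℕ, (T : ℝ) ≤ c * (2 : ℝ) ^ ((n : ℝ) / 2) ∧
        ∃ A : QLearn.StateLearner n Bool T,
          QLearn.IsPurityTester A ∧
            QLearn.DistinguishesHaarUnitaryFromDepolarizing A.onZeroInput := by
  -- A round uses `4 * B + 1 ≤ 5 * B` copies, one of them to draw the phases. With `15000` rounds
  -- and `B ≤ 2 * 2 ^ (n / 2)` this gives `150000`.
  refine ⟨150000, by norm_num, fun n hn => ⟨_, ?_, QLearn.purityTester n,
    QLearn.isPurityTester_purityTester hn,
    QLearn.distinguishes_onZeroInput_of_isPurityTester (QLearn.isPurityTester_purityTester hn)⟩⟩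
  have h1 := QLearn.one_le_batchSize n
  have h2 := QLearn.batchSize_le n
  push_cast
  linarith
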